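/- Let $p\in(0,1)$ and let $M=(M(t))_{t\ge 0}$ be a real-valued continuous local martingale, with respect to some filtration on some probability space, such that $M(0)=0$. Then $$\mathbf E\Big[\Big(\sup_{t\ge 0}M(t)\Big)^p\Big]\;\le\; c_p\,\mathbf E\Big[\Big(-\inf_{t\ge 0}M(t)\Big)^p\Big],\qquad c_p:=\Big(4\wedge\frac1p\Big)\frac{\pi p}{\sin(\pi p)},$$ where $a\wedge b:=\min\{a,b\}$ and both expectations take values in $[0,\infty]$. -/

import Mathlib

open MeasureTheory ProbabilityTheory
open scoped NNReal ENNReal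

/-- A real-valued process `M` indexed by `[0, ∞)` is a continuous local martingale with respect to
the filtration `𝓕` under `P`: it is adapted, almost all its paths are continuous, and there are
stopping times `τ n` that increase almost surely to `∞` such that every stopped process
`1_{τ n > 0} M (t ∧ τ n)` is a martingale. No completeness or right-continuity of `𝓕` is assumed. -/
structure IsContinuousLocalMartingale {Ω : Type*} {mΩ : MeasurableSpace Ω}
    (M : ℝ≥0 → Ω → ℝ) (𝓕 : Filtration ℝ≥0 mΩ) (P : Measure Ω) : Prop where
  stronglyAdapted : StronglyAdapted 𝓕 M
  ae_continuous : ∀ᵐ ω ∂P, Continuous fun t => M t ω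
  locally_martingale : Locally (fun X => Martingale X 𝓕 P) 𝓕 M P

/-- The constant `c_p = (4 ∧ 1/p) · πp / sin(πp)`. -/
noncomputable def burkholderConst (p : ℝ) : ℝ :=
  min 4 (1 / p) * (Real.pi * p / Real.sin (Real.pi * p))

/-!
The proof bounds the tail `P (sup M > x)` by an expectation of a function of `I = -inf M` and then
integrates this bound against `p x ^ (p - 1) dx`.

The tail bound is an Azéma-Yor argument. Let `J` be the running value of `-inf M`. If `g` is
nonincreasing and `G' = g`, then `g(J) (M + J) - G(J)` is a local martingale, because `M + J = 0`
whenever `J` grows. Stop it when `M` reaches `x`: there it equals `g(J) (x + J) - G(J)`, and it is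
always at least `-G(J)`. If therefore `H ≥ G` is nondecreasing and `1 ≤ g(y) (x + y) - G(y) + H(y)`,
then `P (sup M > x) ≤ E H(I)`. Two choices are used (`isAzemaYorTriple_log`,
`isAzemaYorTriple_min`):

* `g(y) = 1 / (x + y)`, `G(y) = H(y) = log (1 + y / x)`, which after integration in `x` gives the
  constant `π / sin (π p) = (1 / p) · π p / sin (π p)`, by the Beta integral
  `∫ x ^ (p - 1) / (1 + x) dx`;
* `g = 1 / x` on `[0, x)`, `G(y) = min y x / x` and `H = 2 G`, which gives `2 / (1 - p)`. This is at
  most `4` if `p ≤ 1 / 4`, and `1 ≤ π p / sin (π p)`.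

Since the filtration is arbitrary and the paths are continuous only almost surely, hitting times in
continuous time are avoided. The argument is run for a martingale in discrete time
(`IsAzemaYorTriple.measure_exists_le`), where `g(J)` becomes a bounded predictable integrand and the
overshoot of a new minimum has to be controlled. Downward steps of size at most `ε` cost at most
`ε g(0)` in total, by a telescoping of `ε g(J)`; the integrand is switched off at the first larger
drop, whose expected cost is at most `E [1 + g(0) |Z_m|]` over the event that such a drop occurs. On
finer and finer grids in a bounded time interval this last term tends to `0` by dominated
convergence (`IsAzemaYorTriple.measure_exists_lt_of_martingale`), and localization
then gives the tail bound for `M` (`IsAzemaYorTriple.measure_exists_lt`).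
-/

/-! ### A pathwise inequality for sequences -/

/-- The conditions on `(g, G, H)` under which `g(J) (M + J) - G(J)` bounds the probability that `M`
reaches `x` by an expectation of `H`. All of them concern arguments in `[0, ∞)`; `increment` is what
remains of `G' = g` for nonincreasing `g`, and allows for jumps of `g`. -/
structure IsAzemaYorTriple (x : ℝ) (g G H : ℝ → ℝ) : Prop where
  measurable_g : Measurable g
  measurable_H : Measurable H
  nonneg : ∀ y, 0 ≤ y → 0 ≤ g y
  antitone : ∀ u v, 0 ≤ u → u ≤ v → g v ≤ g u
  zero : G 0 = 0
  increment : ∀ u v, 0 ≤ u → u ≤ v → g v * (v - u) ≤ G v - G u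
  le : ∀ y, 0 ≤ y → G y ≤ H y
  mono : ∀ u v, 0 ≤ u → u ≤ v → H u ≤ H v
  one_le : ∀ y, 0 ≤ y → 1 ≤ g y * (x + y) - G y + H y

/-- The running value `max_{j ≤ n} (-z j)`, started at `0`; it ignores `z 0`, which is `0` in all
uses. -/
def runningDepth (z : ℕ → ℝ) : ℕ → ℝ
  | 0 => 0
  | n + 1 => max (runningDepth z n) (-z (n + 1))

lemma runningDepth_nonneg (z : ℕ → ℝ) (n : ℕ) : 0 ≤ runningDepth z n := by
  induction n with
  | zero => exact le_rfl
  | succ n ih => exact ih.trans (le_max_left _ _)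

lemma neg_le_runningDepth {z : ℕ → ℝ} (hz : z 0 = 0) (n : ℕ) : -z n ≤ runningDepth z n := by
  cases n with
  | zero => simp [runningDepth, hz]
  | succ n => exact le_max_right _ _

lemma runningDepth_le {z : ℕ → ℝ} {b : ℝ} (hb : 0 ≤ b) {n : ℕ} (h : ∀ j ≤ n, -z j ≤ b) :
    runningDepth z n ≤ b := by
  induction n with
  | zero => exact hb
  | succ n ih => exact max_le (ih fun j hj => h j (hj.trans n.le_succ)) (h _ le_rfl)

/-- Up to time `n` the sequence has stayed below `x` (from time `1` on) and has had no downward step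
larger than `ε`. -/
def IsActive (x ε : ℝ) (z : ℕ → ℝ) (n : ℕ) : Prop :=
  ∀ j < n, z (j + 1) < x ∧ z j - ε ≤ z (j + 1)

lemma isActive_succ {x ε : ℝ} {z : ℕ → ℝ} {n : ℕ} :
    IsActive x ε z (n + 1) ↔ IsActive x ε z n ∧ z (n + 1) < x ∧ z n - ε ≤ z (n + 1) := by
  simp only [IsActive, Nat.lt_succ_iff_lt_or_eq]
  constructor
  · intro h
    exact ⟨fun j hj => h j (.inl hj), h n (.inr rfl)⟩
  · rintro ⟨h, h'⟩ j (hj | rfl)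
    · exact h j hj
    · exact h'

open Classical in
/-- The integrand `g(J)`, switched off at the first time the sequence reaches `x` or drops by more
than `ε` in one step. -/
noncomputable def hedge (x ε : ℝ) (g : ℝ → ℝ) (z : ℕ → ℝ) (n : ℕ) : ℝ :=
  if IsActive x ε z n then g (runningDepth z n) else 0

open Classical in
/-- The cost charged at time `n + 1` if the first drop by more than `ε` happens there, while the
integrand is still switched on. -/
noncomputable def dropCost (x ε c : ℝ) (z : ℕ → ℝ) (n : ℕ) : ℝ :=
  if IsActive x ε z n ∧ z (n + 1) < z n - ε then 1 + c * |z (n + 1)| else 0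

namespace IsAzemaYorTriple

variable {x ε : ℝ} {g G H : ℝ → ℝ} (h : IsAzemaYorTriple x g G H)
include h

lemma G_mono {u v : ℝ} (hu : 0 ≤ u) (huv : u ≤ v) : G u ≤ G v := by
  have := h.increment u v hu huv
  have := mul_nonneg (h.nonneg v (hu.trans huv)) (sub_nonneg.2 huv)
  linarith

lemma G_nonneg {u : ℝ} (hu : 0 ≤ u) : 0 ≤ G u := h.zero ▸ h.G_mono le_rfl hu

/-- One step of the potential `g(J) (z + J + ε) - G(J)`: if the downward step is at most `ε`, its
increment is at most that of the discrete stochastic integral. The summand `ε g(J)` pays for the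
overshoot of a new minimum. -/
lemma potential_step {z J z' : ℝ} (hJ : 0 ≤ J) (hzJ : -z ≤ J) (hd : z - ε ≤ z') :
    g (max J (-z')) * (z' + max J (-z') + ε) - G (max J (-z')) ≤
      g J * (z + J + ε) - G J + g J * (z' - z) := by
  rcases le_total (-z') J with hc | hc
  · rw [max_eq_left hc]
    linarith
  · rw [max_eq_right hc]
    have h1 := h.increment J (-z') hJ hc
    have h2 := mul_nonneg (sub_nonneg.2 (h.antitone J (-z') hJ hc))
      (by linarith : 0 ≤ ε - (-z' - J))
    linarith

/-- As long as the integrand is switched on, the stochastic integral dominates the potential; once it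
is switched off, it already dominates `1` up to the error terms. -/
lemma sum_hedge_bounds {z : ℕ → ℝ} (hz : z 0 = 0) (hε : 0 ≤ ε) (n : ℕ) :
    (IsActive x ε z n → g (runningDepth z n) * (z n + runningDepth z n + ε) - G (runningDepth z n) ≤
      ε * g 0 + ∑ j ∈ Finset.range n, hedge x ε g z j * (z (j + 1) - z j)) ∧
    (¬ IsActive x ε z n → 1 ≤
      ε * g 0 + ∑ j ∈ Finset.range n, hedge x ε g z j * (z (j + 1) - z j) + H (runningDepth z n) +
        ∑ j ∈ Finset.range n, dropCost x ε (g 0) z j) := by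
  have hg0 := h.nonneg 0 le_rfl
  have hR : ∀ n, 0 ≤ dropCost x ε (g 0) z n := by
    intro n
    unfold dropCost
    split_ifs <;> positivity
  induction n with
  | zero =>
    refine ⟨fun _ => ?_, fun hn => (hn fun j hj => absurd hj j.not_lt_zero).elim⟩
    simp [runningDepth, hz, h.zero, mul_comm]
  | succ n ih =>
    have hJ := runningDepth_nonneg z n
    have hzJ := neg_le_runningDepth hz n
    have hJ' : runningDepth z (n + 1) = max (runningDepth z n) (-z (n + 1)) := rfl
    have hJJ' : runningDepth z n ≤ runningDepth z (n + 1) := le_max_left _ _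
    rw [Finset.sum_range_succ, Finset.sum_range_succ]
    by_cases hn : IsActive x ε z n
    · have hh : hedge x ε g z n = g (runningDepth z n) := if_pos hn
      have ih1 := ih.1 hn
      rw [hh]
      by_cases hd : z n - ε ≤ z (n + 1)
      -- A small step: the potential argument applies, and if the integrand is now switched off,
      -- the reason is that `x` has been reached.
      · have hs := h.potential_step hJ hzJ hd
        rw [← hJ'] at hs
        refine ⟨fun _ => by linarith, fun hn' => ?_⟩
        have hx : x ≤ z (n + 1) := by
          by_contra! hx
          exact hn' (isActive_succ.2 ⟨hn, hx, hd⟩)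
        have hJ1 := runningDepth_nonneg z (n + 1)
        have h1 := h.one_le _ hJ1
        have h2 := mul_le_mul_of_nonneg_left
          (by linarith : x + runningDepth z (n + 1) ≤ z (n + 1) + runningDepth z (n + 1) + ε)
          (h.nonneg _ hJ1)
        have h3 := Finset.sum_nonneg fun j (_ : j ∈ Finset.range n) => hR j
        have h4 := hR n
        linarith
      -- A large drop: `dropCost` pays both for the `1` and for the loss of the integral.
      · refine ⟨fun hn' => (hd (isActive_succ.1 hn').2.2).elim, fun _ => ?_⟩
        have hc : dropCost x ε (g 0) z n = 1 + g 0 * |z (n + 1)| := if_pos ⟨hn, not_le.1 hd⟩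
        have h1 := h.le _ (runningDepth_nonneg z (n + 1))
        have h2 := h.G_mono hJ hJJ'
        have h3 := Finset.sum_nonneg fun j (_ : j ∈ Finset.range n) => hR j
        have h4 : g (runningDepth z n) * -(runningDepth z n + ε + z (n + 1)) ≤
            g 0 * |z (n + 1)| :=
          (mul_le_mul_of_nonneg_left (by linarith [neg_le_abs (z (n + 1))])
            (h.nonneg _ hJ)).trans
            (mul_le_mul_of_nonneg_right (h.antitone 0 _ le_rfl hJ) (abs_nonneg _))
        rw [hc]
        linarith
    · refine ⟨fun hn' => (hn (isActive_succ.1 hn').1).elim, fun _ => ?_⟩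
      have hh : hedge x ε g z n = 0 := if_neg hn
      have h1 := ih.2 hn
      have h2 := h.mono _ _ hJ hJJ'
      have h4 := hR n
      rw [hh]
      linarith

open Classical in
/-- The pathwise inequality behind the tail bound: the indicator that `x` is reached is at most a
discrete stochastic integral plus `H` of the running depth and the error terms. -/
lemma indicator_le_sum_hedge (hx : 0 < x) {z : ℕ → ℝ} (hz : z 0 = 0) (hε : 0 ≤ ε) (m : ℕ) :
    (if ∃ j ≤ m, x ≤ z j then (1 : ℝ) else 0) ≤
      ε * g 0 + ∑ j ∈ Finset.range m, hedge x ε g z j * (z (j + 1) - z j) +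
        H (runningDepth z m) + ∑ j ∈ Finset.range m, dropCost x ε (g 0) z j := by
  by_cases hm : IsActive x ε z m
  · have h1 := (h.sum_hedge_bounds hz hε m).1 hm
    have hJ := runningDepth_nonneg z m
    have h2 := mul_nonneg (h.nonneg _ hJ)
      (by linarith [neg_le_runningDepth hz m] : 0 ≤ z m + runningDepth z m + ε)
    have h3 := h.le _ hJ
    have h4 : 0 ≤ ∑ j ∈ Finset.range m, dropCost x ε (g 0) z j := by
      refine Finset.sum_nonneg fun j _ => ?_
      have := h.nonneg 0 le_rfl
      unfold dropCost
      split_ifs <;> positivity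
    rw [if_neg]
    · linarith
    · rintro ⟨j, hj, hxj⟩
      cases j with
      | zero => linarith
      | succ j => exact absurd (hm j hj).1 (not_lt.2 hxj)
  · refine le_trans ?_ ((h.sum_hedge_bounds hz hε m).2 hm)
    split_ifs <;> norm_num

end IsAzemaYorTriple

/-! ### The tail bound for discrete martingales -/

section Discrete

variable {Ω : Type*} {mΩ : MeasurableSpace Ω} {P : Measure Ω} {𝒢 : Filtration ℕ mΩ}
  {Z : ℕ → Ω → ℝ} {x ε : ℝ} {g G H : ℝ → ℝ}

lemma measurable_runningDepth (hZ : StronglyAdapted 𝒢 Z) (n : ℕ) :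
    Measurable[𝒢 n] fun ω => runningDepth (fun i => Z i ω) n := by
  induction n with
  | zero => exact measurable_const
  | succ n ih =>
    exact (ih.mono (𝒢.mono n.le_succ) le_rfl).max (hZ (n + 1)).measurable.neg

lemma measurableSet_isActive (hZ : StronglyAdapted 𝒢 Z) (n : ℕ) :
    MeasurableSet[𝒢 n] {ω | IsActive x ε (fun i => Z i ω) n} := by
  induction n with
  | zero => simp [IsActive]
  | succ n ih =>
    simp only [isActive_succ]
    have h1 := (hZ (n + 1)).measurable
    have h0 := (hZ n).measurable.mono (𝒢.mono n.le_succ) le_rfl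
    exact (𝒢.mono n.le_succ _ ih).inter
      ((measurableSet_lt h1 measurable_const).inter (measurableSet_le (h0.sub_const ε) h1))

lemma stronglyAdapted_hedge (hg : Measurable g) (hZ : StronglyAdapted 𝒢 Z) :
    StronglyAdapted 𝒢 fun n ω => hedge x ε g (fun i => Z i ω) n := fun n =>
  (Measurable.ite (measurableSet_isActive hZ n) (hg.comp (measurable_runningDepth hZ n))
    measurable_const).stronglyMeasurable

/-- The first large drop happens at one time at most, and `|Z|` is a submartingale, so that `|Z|` at
this time may be replaced by `|Z m|` in expectation. -/
lemma integral_sum_dropCost_le [IsFiniteMeasure P] (hZ : Martingale Z 𝒢 P) {c : ℝ} (hc : 0 ≤ c)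
    (m : ℕ) :
    (∀ j, Integrable (fun ω => dropCost x ε c (fun i => Z i ω) j) P) ∧
    ∫ ω, ∑ j ∈ Finset.range m, dropCost x ε c (fun i => Z i ω) j ∂P ≤
      ∫ ω in {ω | ∃ j < m, Z (j + 1) ω < Z j ω - ε}, (1 + c * |Z m ω|) ∂P := by
  set D : ℕ → Set Ω := fun j =>
    {ω | IsActive x ε (fun i => Z i ω) j ∧ Z (j + 1) ω < Z j ω - ε} with hD
  have hDm' : ∀ j, MeasurableSet[𝒢 (j + 1)] (D j) := fun j =>
    (𝒢.mono j.le_succ _ (measurableSet_isActive hZ.1 j)).inter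
      (measurableSet_lt (hZ.1 (j + 1)).measurable
        (((hZ.1 j).measurable.mono (𝒢.mono j.le_succ) le_rfl).sub_const ε))
  have hDm : ∀ j, MeasurableSet (D j) := fun j => 𝒢.le _ _ (hDm' j)
  have hsub : Submartingale (fun j ω => |Z j ω|) 𝒢 P := by
    simpa [abs, Pi.sup_def] using hZ.submartingale.sup hZ.neg.submartingale
  have hint : ∀ j, Integrable (fun ω => 1 + c * |Z j ω|) P := fun j =>
    (integrable_const _).add ((hsub.integrable j).const_mul c)
  have heq : ∀ j, (fun ω => dropCost x ε c (fun i => Z i ω) j) =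
      (D j).indicator fun ω => 1 + c * |Z (j + 1) ω| := by
    intro j
    ext ω
    by_cases hω : ω ∈ D j
    · rw [Set.indicator_of_mem hω]
      exact if_pos hω
    · rw [Set.indicator_of_notMem hω]
      exact if_neg hω
  have hdi : ∀ j, Integrable (fun ω => dropCost x ε c (fun i => Z i ω) j) P := by
    intro j
    rw [heq j]
    exact (hint _).indicator (hDm j)
  refine ⟨hdi, ?_⟩
  rw [integral_finsetSum _ fun j _ => hdi j]
  calc ∑ j ∈ Finset.range m, ∫ ω, dropCost x ε c (fun i => Z i ω) j ∂P
      ≤ ∑ j ∈ Finset.range m, ∫ ω in D j, (1 + c * |Z m ω|) ∂P := by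
        refine Finset.sum_le_sum fun j hj => ?_
        rw [heq j, integral_indicator (hDm j),
          integral_add (integrable_const _) ((hsub.integrable _).const_mul c).integrableOn,
          integral_add (integrable_const _) ((hsub.integrable _).const_mul c).integrableOn,
          integral_const_mul, integral_const_mul]
        have hle : ∫ ω in D j, |Z (j + 1) ω| ∂P ≤ ∫ ω in D j, |Z m ω| ∂P :=
          hsub.setIntegral_le (Finset.mem_range.1 hj) (hDm' j)
        exact add_le_add le_rfl (mul_le_mul_of_nonneg_left hle hc)
    _ = ∫ ω in ⋃ j ∈ Finset.range m, D j, (1 + c * |Z m ω|) ∂P := by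
        refine (integral_biUnion_finset _ (fun j _ => hDm j) ?_ fun j _ =>
          (hint m).integrableOn).symm
        have key : ∀ i j, i < j → Disjoint (D i) (D j) := fun i j hij =>
          Set.disjoint_left.2 fun ω hi hj => absurd (hj.1 i hij).2 (not_le.2 hi.2)
        intro i _ j _ hij
        rcases lt_or_gt_of_ne hij with hlt | hlt
        · exact key i j hlt
        · exact (key j i hlt).symm
    _ ≤ ∫ ω in {ω | ∃ j < m, Z (j + 1) ω < Z j ω - ε}, (1 + c * |Z m ω|) ∂P := by
        refine setIntegral_mono_set (hint m).integrableOn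
          (Filter.Eventually.of_forall fun ω => by positivity) (LE.le.eventuallyLE ?_)
        intro ω hω
        simp only [Set.mem_iUnion, Finset.mem_range] at hω
        obtain ⟨j, hj, hω⟩ := hω
        exact ⟨j, hj, hω.2⟩

/-- The tail bound for a discrete martingale, with the error made by jumps. -/
lemma IsAzemaYorTriple.measure_exists_le [IsProbabilityMeasure P] (h : IsAzemaYorTriple x g G H)
    (hx : 0 < x) (hε : 0 ≤ ε) (hZ : Martingale Z 𝒢 P) (hZ0 : ∀ᵐ ω ∂P, Z 0 ω = 0) (m : ℕ) :
    P {ω | ∃ j ≤ m, x ≤ Z j ω} ≤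
      ENNReal.ofReal (ε * g 0) + ∫⁻ ω, ENNReal.ofReal (H (runningDepth (fun i => Z i ω) m)) ∂P +
        ∫⁻ ω in {ω | ∃ j < m, Z (j + 1) ω < Z j ω - ε}, ENNReal.ofReal (1 + g 0 * |Z m ω|) ∂P := by
  classical
  have hg0 := h.nonneg 0 le_rfl
  have hHm : Measurable fun ω => H (runningDepth (fun i => Z i ω) m) :=
    h.measurable_H.comp ((measurable_runningDepth hZ.1 m).mono (𝒢.le m) le_rfl)
  have hH0 : ∀ ω, 0 ≤ H (runningDepth (fun i => Z i ω) m) := fun ω =>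
    (h.G_nonneg (runningDepth_nonneg _ _)).trans (h.le _ (runningDepth_nonneg _ _))
  -- If `H` of the running depth is not integrable, its Bochner integral would be a junk value.
  by_cases hfin : ∫⁻ ω, ENNReal.ofReal (H (runningDepth (fun i => Z i ω) m)) ∂P = ∞
  · simp [hfin]
  have hHi : Integrable (fun ω => H (runningDepth (fun i => Z i ω) m)) P :=
    (lintegral_ofReal_ne_top_iff_integrable hHm.aestronglyMeasurable
      (Filter.Eventually.of_forall hH0)).1 hfin
  have hadp := stronglyAdapted_hedge (x := x) (ε := ε) h.measurable_g hZ.1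
  have hbd : ∀ n ω, hedge x ε g (fun i => Z i ω) n ≤ g 0 := by
    intro n ω
    unfold hedge
    split_ifs
    · exact h.antitone 0 _ le_rfl (runningDepth_nonneg _ _)
    · exact hg0
  have hnn : ∀ n ω, 0 ≤ hedge x ε g (fun i => Z i ω) n := by
    intro n ω
    unfold hedge
    split_ifs
    · exact h.nonneg _ (runningDepth_nonneg _ _)
    · exact le_rfl
  have hsub := hZ.neg.submartingale.sum_mul_sub hadp hbd hnn
  have hmono := hsub.setIntegral_le (Nat.zero_le m) MeasurableSet.univ
  have hVi := (hsub.integrable m).neg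
  have hVeq : ∀ ω, (-∑ k ∈ Finset.range m, (fun ω => hedge x ε g (fun i => Z i ω) k) *
      ((-Z) (k + 1) - (-Z) k)) ω = ∑ j ∈ Finset.range m,
        hedge x ε g (fun i => Z i ω) j * (Z (j + 1) ω - Z j ω) := by
    intro ω
    simp only [Pi.neg_apply, Finset.sum_apply, Pi.mul_apply, Pi.sub_apply]
    rw [← Finset.sum_neg_distrib]
    exact Finset.sum_congr rfl fun j _ => by ring
  have hVi' : Integrable (fun ω => ∑ j ∈ Finset.range m,
      hedge x ε g (fun i => Z i ω) j * (Z (j + 1) ω - Z j ω)) P :=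
    hVi.congr (Filter.Eventually.of_forall hVeq)
  have hV0 : ∫ ω, ∑ j ∈ Finset.range m,
      hedge x ε g (fun i => Z i ω) j * (Z (j + 1) ω - Z j ω) ∂P ≤ 0 := by
    rw [← integral_congr_ae (Filter.Eventually.of_forall hVeq)]
    simp only [Pi.neg_apply]
    rw [integral_neg]
    simpa using hmono
  obtain ⟨hdi, hdrop⟩ := integral_sum_dropCost_le (x := x) (ε := ε) hZ hg0 m
  have hdi' : Integrable (fun ω => ∑ j ∈ Finset.range m,
    dropCost x ε (g 0) (fun i => Z i ω) j) P := integrable_finsetSum _ fun j _ => hdi j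
  have hAm : MeasurableSet {ω | ∃ j ≤ m, x ≤ Z j ω} := by
    simp only [Set.ofPred_exists]
    refine MeasurableSet.iUnion fun j => ?_
    by_cases hj : j ≤ m
    · simpa [hj] using measurableSet_le measurable_const ((hZ.1 j).measurable.mono (𝒢.le j) le_rfl)
    · simp [hj]
  have hi1 : Integrable (fun ω => ε * g 0 + ∑ j ∈ Finset.range m,
      hedge x ε g (fun i => Z i ω) j * (Z (j + 1) ω - Z j ω)) P :=
    (integrable_const _).add hVi'
  have hi2 : Integrable (fun ω => ε * g 0 + ∑ j ∈ Finset.range m,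
      hedge x ε g (fun i => Z i ω) j * (Z (j + 1) ω - Z j ω) +
      H (runningDepth (fun i => Z i ω) m)) P := hi1.add hHi
  have hreal : P.real {ω | ∃ j ≤ m, x ≤ Z j ω} ≤ ε * g 0 +
      ∫ ω, H (runningDepth (fun i => Z i ω) m) ∂P +
        ∫ ω in {ω | ∃ j < m, Z (j + 1) ω < Z j ω - ε}, (1 + g 0 * |Z m ω|) ∂P := by
    rw [← integral_indicator_one hAm]
    have h1 : ∫ ω, {ω | ∃ j ≤ m, x ≤ Z j ω}.indicator 1 ω ∂P ≤ ∫ ω, (ε * g 0 +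
        ∑ j ∈ Finset.range m, hedge x ε g (fun i => Z i ω) j * (Z (j + 1) ω - Z j ω) +
        H (runningDepth (fun i => Z i ω) m) +
        ∑ j ∈ Finset.range m, dropCost x ε (g 0) (fun i => Z i ω) j) ∂P := by
      refine integral_mono_ae ((integrable_const (1 : ℝ)).indicator hAm)
        (hi2.add hdi') ?_
      filter_upwards [hZ0] with ω hω
      have := h.indicator_le_sum_hedge hx (z := fun i => Z i ω) hω hε m
      simpa [Set.indicator_apply] using this
    rw [integral_add hi2 hdi', integral_add hi1 hHi,
      integral_add (integrable_const _) hVi'] at h1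
    simp only [integral_const, probReal_univ, one_smul] at h1
    linarith
  have hint : Integrable (fun ω => 1 + g 0 * |Z m ω|) P :=
    (integrable_const _).add ((hZ.integrable m).abs.const_mul _)
  rw [← ofReal_integral_eq_lintegral_ofReal hHi (Filter.Eventually.of_forall hH0),
    ← ofReal_integral_eq_lintegral_ofReal hint.integrableOn
      (Filter.Eventually.of_forall fun ω => by positivity),
    ← ENNReal.ofReal_add (by positivity) (integral_nonneg hH0),
    ← ENNReal.ofReal_add (add_nonneg (by positivity) (integral_nonneg hH0))
      (integral_nonneg fun ω => by positivity),
    ← ofReal_measureReal]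
  exact ENNReal.ofReal_le_ofReal hreal

end Discrete

/-! ### The tail bound for continuous local martingales -/

section Continuous

open Filter Topology

/-- A form of `P (liminf A) ≤ liminf P A` in which neither `E` nor `A k` need be measurable. -/
lemma measure_le_of_eventually_mem {Ω : Type*} {mΩ : MeasurableSpace Ω} {P : Measure Ω}
    {A : ℕ → Set Ω} {E : Set Ω} {b : ℕ → ℝ≥0∞} {c : ℝ≥0∞}
    (hE : ∀ᵐ ω ∂P, ω ∈ E → ∀ᶠ k in atTop, ω ∈ A k) (hb : ∀ k, P (A k) ≤ b k)
    (hlim : Tendsto b atTop (𝓝 c)) : P E ≤ c := by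
  have hmono : Monotone fun k => ⋂ l ≥ k, A l := fun k k' hk =>
    Set.biInter_subset_biInter_left fun l hl => hk.trans hl
  calc P E ≤ P (⋃ k, ⋂ l ≥ k, A l) := by
        refine measure_mono_ae ?_
        filter_upwards [hE] with ω hω hωE
        obtain ⟨k, hk⟩ := eventually_atTop.1 (hω hωE)
        exact Set.mem_iUnion.2 ⟨k, Set.mem_iInter₂.2 hk⟩
    _ = ⨆ k, P (⋂ l ≥ k, A l) := hmono.measure_iUnion
    _ ≤ c := by
        refine iSup_le fun k => ge_of_tendsto hlim ?_
        filter_upwards [eventually_ge_atTop k] with l hl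
        exact (measure_mono (Set.biInter_subset_of_mem hl)).trans (hb l)

/-- The `j`-th point of the grid of mesh `1 / (k + 1)` in `[0, ∞)`. -/
noncomputable def gridTime (k j : ℕ) : ℝ≥0 := j / (k + 1)

lemma gridTime_mono (k : ℕ) : Monotone (gridTime k) := fun i j hij => by
  unfold gridTime
  gcongr

lemma gridTime_mul (n k : ℕ) : gridTime k (n * (k + 1)) = n := by
  unfold gridTime
  push_cast
  exact mul_div_cancel_right₀ _ (by positivity)

lemma dist_gridTime_succ (k j : ℕ) : dist (gridTime k (j + 1)) (gridTime k j) = 1 / (k + 1) := by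
  rw [NNReal.dist_eq]
  unfold gridTime
  push_cast
  rw [← sub_div, abs_of_nonneg (by simp; positivity)]
  ring

lemma dist_gridTime_floor (k : ℕ) (t : ℝ≥0) :
    dist (gridTime k ⌊t * (k + 1)⌋₊) t ≤ 1 / (k + 1) := by
  have h1 : ((⌊t * (k + 1)⌋₊ : ℝ≥0) : ℝ) ≤ t * (k + 1) := by
    exact_mod_cast Nat.floor_le (zero_le (a := t * (k + 1)))
  have h2 : (t * (k + 1) : ℝ) < (⌊t * (k + 1)⌋₊ : ℝ≥0) + 1 := by
    exact_mod_cast Nat.lt_floor_add_one (t * (k + 1))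
  have hk : (0 : ℝ) < k + 1 := by positivity
  rw [NNReal.dist_eq]
  unfold gridTime
  push_cast at h1 h2 ⊢
  rw [abs_le]
  constructor
  · rw [neg_le_sub_iff_le_add, ← add_div, le_div_iff₀ hk]
    exact h2.le
  · rw [sub_le_iff_le_add]
    exact ((div_le_iff₀ hk).2 h1).trans (by simp; positivity)

lemma eventually_not_drop {X : ℝ≥0 → ℝ} (hX : Continuous X) (n : ℕ) {ε : ℝ} (hε : 0 < ε) :
    ∀ᶠ k in atTop, ¬ ∃ j < n * (k + 1), X (gridTime k (j + 1)) < X (gridTime k j) - ε := by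
  have huc := (isCompact_Icc (a := (0 : ℝ≥0)) (b := n)).uniformContinuousOn_of_continuous
    hX.continuousOn
  obtain ⟨δ, hδ, hu⟩ := Metric.uniformContinuousOn_iff.1 huc ε hε
  filter_upwards [(tendsto_one_div_add_atTop_nhds_zero_nat (𝕜 := ℝ)).eventually_lt_const hδ]
    with k hk
  rintro ⟨j, hj, hlt⟩
  have hm : ∀ i ≤ n * (k + 1), gridTime k i ∈ Set.Icc (0 : ℝ≥0) n := fun i hi =>
    ⟨zero_le, (gridTime_mono k hi).trans_eq (gridTime_mul n k)⟩
  have := hu _ (hm (j + 1) hj) _ (hm j hj.le) (by rw [dist_gridTime_succ]; exact hk)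
  rw [Real.dist_eq] at this
  linarith [(abs_lt.1 this).1]

lemma eventually_exists_gridTime {X : ℝ≥0 → ℝ} (hX : Continuous X) {n : ℕ} {x : ℝ}
    (h : ∃ t : ℝ≥0, t ≤ n ∧ x < X t) :
    ∀ᶠ k in atTop, ∃ j ≤ n * (k + 1), x ≤ X (gridTime k j) := by
  obtain ⟨t, htn, hxt⟩ := h
  have hlim : Tendsto (fun k : ℕ => gridTime k ⌊t * (k + 1)⌋₊) atTop (𝓝 t) :=
    tendsto_iff_dist_tendsto_zero.2 (squeeze_zero (fun _ => dist_nonneg)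
      (fun k => dist_gridTime_floor k t) tendsto_one_div_add_atTop_nhds_zero_nat)
  filter_upwards [((hX.tendsto t).comp hlim).eventually_const_lt hxt] with k hk
  refine ⟨_, ?_, hk.le⟩
  have : (⌊t * (k + 1)⌋₊ : ℝ≥0) ≤ n * (k + 1) :=
    (Nat.floor_le zero_le).trans (by gcongr)
  exact_mod_cast this

variable {Ω : Type*} {mΩ : MeasurableSpace Ω} {P : Measure Ω} [IsProbabilityMeasure P]
  {𝓕 : Filtration ℝ≥0 mΩ} {x : ℝ} {g G H : ℝ → ℝ}

namespace IsAzemaYorTriple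

/-- The tail bound for a martingale with almost surely continuous paths on a bounded time
interval. -/
lemma measure_exists_lt_of_martingale (h : IsAzemaYorTriple x g G H) (hx : 0 < x)
    {X : ℝ≥0 → Ω → ℝ} (hX : Martingale X 𝓕 P) (hc : ∀ᵐ ω ∂P, Continuous fun t => X t ω)
    (hX0 : ∀ᵐ ω ∂P, X 0 ω = 0) {i : Ω → ℝ} (hi0 : ∀ ω, 0 ≤ i ω)
    (hi : ∀ᵐ ω ∂P, ∀ t, -X t ω ≤ i ω) (n : ℕ) :
    P {ω | ∃ t : ℝ≥0, t ≤ n ∧ x < X t ω} ≤ ∫⁻ ω, ENNReal.ofReal (H (i ω)) ∂P := by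
  have hg0 := h.nonneg 0 le_rfl
  have hfix : ∀ ε > 0, P {ω | ∃ t : ℝ≥0, t ≤ n ∧ x < X t ω} ≤
      ENNReal.ofReal (ε * g 0) + ∫⁻ ω, ENNReal.ofReal (H (i ω)) ∂P := by
    intro ε hε
    set B : ℕ → Set Ω := fun k =>
      {ω | ∃ j < n * (k + 1), X (gridTime k (j + 1)) ω < X (gridTime k j) ω - ε} with hB
    have hXm : ∀ t, Measurable (X t) := fun t => (hX.1 t).measurable.mono (𝓕.le t) le_rfl
    have hBm : ∀ k, MeasurableSet (B k) := by
      intro k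
      have : B k = ⋃ j ∈ Finset.range (n * (k + 1)),
          {ω | X (gridTime k (j + 1)) ω < X (gridTime k j) ω - ε} := by
        ext ω
        simp [hB]
      rw [this]
      exact Finset.measurableSet_biUnion _ fun j _ =>
        measurableSet_lt (hXm _) ((hXm _).sub_const ε)
    have hfm : Measurable fun ω => ENNReal.ofReal (1 + g 0 * |X n ω|) :=
      (measurable_const.add ((hXm n).abs.const_mul _)).ennreal_ofReal
    have hfi : ∫⁻ ω, ENNReal.ofReal (1 + g 0 * |X n ω|) ∂P ≠ ∞ :=
      ((integrable_const (1 : ℝ)).add ((hX.integrable n).abs.const_mul (g 0))).lintegral_lt_top.ne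
    have hdrop : Tendsto (fun k => ∫⁻ ω in B k, ENNReal.ofReal (1 + g 0 * |X n ω|) ∂P) atTop
        (𝓝 0) := by
      have := tendsto_lintegral_of_dominated_convergence (μ := P)
        (F := fun k => (B k).indicator fun ω => ENNReal.ofReal (1 + g 0 * |X n ω|))
        (f := fun _ => 0) (fun ω => ENNReal.ofReal (1 + g 0 * |X n ω|))
        (fun k => hfm.indicator (hBm k))
        (fun k => Eventually.of_forall fun ω => Set.indicator_le_self _ _ ω) hfi ?_
      · simpa only [lintegral_indicator (hBm _), lintegral_zero] using this
      · filter_upwards [hc] with ω hω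
        refine tendsto_const_nhds.congr' ?_
        filter_upwards [eventually_not_drop hω n hε] with k hk
        exact (Set.indicator_of_notMem (s := B k) hk _).symm
    refine measure_le_of_eventually_mem
      (A := fun k => {ω | ∃ j ≤ n * (k + 1), x ≤ X (gridTime k j) ω})
      (b := fun k => ENNReal.ofReal (ε * g 0) + ∫⁻ ω, ENNReal.ofReal (H (i ω)) ∂P +
        ∫⁻ ω in B k, ENNReal.ofReal (1 + g 0 * |X n ω|) ∂P) ?_ ?_ ?_
    · filter_upwards [hc] with ω hω hE
      exact eventually_exists_gridTime hω hE
    · intro k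
      let 𝒢 : Filtration ℕ mΩ :=
        ⟨fun j => 𝓕 (gridTime k j), fun a b hab => 𝓕.mono (gridTime_mono k hab), fun j => 𝓕.le _⟩
      have hZ : Martingale (fun j => X (gridTime k j)) 𝒢 P :=
        ⟨fun j => hX.1 _, fun a b hab => hX.2 _ _ (gridTime_mono k hab)⟩
      have h0 : gridTime k 0 = 0 := by simp [gridTime]
      have key := h.measure_exists_le hx hε.le hZ (by simpa only [h0] using hX0) (n * (k + 1))
      rw [gridTime_mul] at key
      refine key.trans ?_
      gcongr ?_ + ?_ + ?_
      · exact le_rfl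
      · refine lintegral_mono_ae ?_
        filter_upwards [hi] with ω hω
        exact ENNReal.ofReal_le_ofReal (h.mono _ _ (runningDepth_nonneg _ _)
          (runningDepth_le (hi0 ω) fun j _ => hω _))
      · exact le_rfl
    · simpa using hdrop.const_add
        (ENNReal.ofReal (ε * g 0) + ∫⁻ ω, ENNReal.ofReal (H (i ω)) ∂P)
  -- The mesh has been sent to `0` with `ε` fixed; now `ε` tends to `0`.
  have hlim : Tendsto (fun ε : ℝ => ENNReal.ofReal (ε * g 0) +
      ∫⁻ ω, ENNReal.ofReal (H (i ω)) ∂P) (𝓝[>] 0) (𝓝 (∫⁻ ω, ENNReal.ofReal (H (i ω)) ∂P)) := by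
    have h1 : Tendsto (fun ε : ℝ => ENNReal.ofReal (ε * g 0)) (𝓝[>] 0) (𝓝 0) := by
      have : Tendsto (fun ε : ℝ => ENNReal.ofReal (ε * g 0)) (𝓝 0)
          (𝓝 (ENNReal.ofReal (0 * g 0))) :=
        (ENNReal.continuous_ofReal.comp (continuous_id.mul continuous_const)).tendsto 0
      simpa using this.mono_left nhdsWithin_le_nhds
    simpa using h1.add_const (∫⁻ ω, ENNReal.ofReal (H (i ω)) ∂P)
  refine ge_of_tendsto hlim ?_
  filter_upwards [self_mem_nhdsWithin] with ε hε
  exact hfix ε hε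

/-- The tail bound `P (sup M > x) ≤ E H(i)` for a continuous local martingale, where `i` is any
finite bound of `-inf M`. -/
lemma measure_exists_lt (h : IsAzemaYorTriple x g G H) (hx : 0 < x)
    {M : ℝ≥0 → Ω → ℝ} (hM : IsContinuousLocalMartingale M 𝓕 P)
    (hM0 : ∀ᵐ ω ∂P, M 0 ω = 0) {i : Ω → ℝ} (hi0 : ∀ ω, 0 ≤ i ω)
    (hi : ∀ᵐ ω ∂P, ∀ t, -M t ω ≤ i ω) :
    P {ω | ∃ t : ℝ≥0, x < M t ω} ≤ ∫⁻ ω, ENNReal.ofReal (H (i ω)) ∂P := by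
  obtain ⟨τ, hτ, hmart⟩ := hM.locally_martingale
  set X : ℕ → ℝ≥0 → Ω → ℝ := fun n =>
    stoppedProcess (fun i => {ω | ⊥ < τ n ω}.indicator (M i)) (τ n) with hX
  have hXeq : ∀ n t ω, X n t ω =
      if ⊥ < τ n ω then M (min (t : WithTop ℝ≥0) (τ n ω)).untopA ω else 0 := by
    intro n t ω
    simp [hX, stoppedProcess, Set.indicator_apply]
  have hmin : ∀ t s : ℝ≥0, (min (t : WithTop ℝ≥0) s).untopA = min t s := fun t s => by
    rw [← WithTop.coe_min]
    rfl
  have hmin_top : ∀ t : ℝ≥0, (min (t : WithTop ℝ≥0) ⊤).untopA = t := fun t => by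
    rw [min_eq_left le_top]
    rfl
  refine measure_le_of_eventually_mem
    (A := fun n => {ω | ∃ t : ℝ≥0, t ≤ n ∧ x < X n t ω}) ?_
    (fun n => h.measure_exists_lt_of_martingale hx (hmart n) ?_ ?_ hi0 ?_ n) tendsto_const_nhds
  · filter_upwards [hτ.tendsto_top] with ω hω hE
    obtain ⟨t, ht⟩ := hE
    filter_upwards [hω.eventually_const_lt (WithTop.coe_lt_top t),
      eventually_ge_atTop ⌈t⌉₊] with n hn htn
    refine ⟨t, Nat.ceil_le.1 htn, ?_⟩
    rw [hXeq, if_pos (bot_le.trans_lt hn), min_eq_left hn.le]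
    exact ht
  · filter_upwards [hM.ae_continuous] with ω hω
    change Continuous fun t => X n t ω
    simp only [hXeq]
    split_ifs with hpos
    · by_cases hτω : τ n ω = ⊤
      · simp only [hτω, hmin_top]
        exact hω
      · obtain ⟨s, hs⟩ := WithTop.ne_top_iff_exists.1 hτω
        simp only [← hs, hmin]
        exact hω.comp (continuous_id.min continuous_const)
    · exact continuous_const
  · filter_upwards [hM0] with ω hω
    change X n 0 ω = 0
    rw [hXeq]
    split_ifs
    · have : (min ((0 : ℝ≥0) : WithTop ℝ≥0) (τ n ω)).untopA = 0 := by
        rw [min_eq_left (by simp)]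
        rfl
      rw [this, hω]
    · rfl
  · filter_upwards [hi] with ω hω t
    change -X n t ω ≤ i ω
    rw [hXeq]
    split_ifs
    · exact hω _
    · simpa using hi0 ω

end IsAzemaYorTriple

end Continuous

/-! ### Two choices of the triple, and their integrals over the level -/

section Triples

lemma isAzemaYorTriple_log {x : ℝ} (hx : 0 < x) :
    IsAzemaYorTriple x (fun y => 1 / (x + y)) (fun y => Real.log (1 + y / x))
      (fun y => Real.log (1 + y / x)) where
  measurable_g := by fun_prop
  measurable_H := by fun_prop
  nonneg y hy := by positivity
  antitone u v hu huv := by gcongr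
  zero := by simp
  increment u v hu huv := by
    have hv := hu.trans huv
    have h := Real.one_sub_inv_le_log_of_pos (x := (x + v) / (x + u)) (by positivity)
    have h1 : 1 + v / x = (x + v) / x := by field_simp
    have h2 : 1 + u / x = (x + u) / x := by field_simp
    rw [h1, h2, ← Real.log_div (by positivity) (by positivity),
      div_div_div_cancel_right₀ hx.ne']
    refine le_trans (le_of_eq ?_) h
    field_simp
    ring
  le y _ := le_rfl
  mono u v hu huv := by gcongr
  one_le y hy := by
    have : x + y ≠ 0 := by positivity
    field_simp
    simp

lemma isAzemaYorTriple_min {x : ℝ} (hx : 0 < x) :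
    IsAzemaYorTriple x (fun y => if y < x then 1 / x else 0) (fun y => min y x / x)
      (fun y => 2 * (min y x / x)) where
  measurable_g := Measurable.ite measurableSet_Iio measurable_const measurable_const
  measurable_H := by fun_prop
  nonneg y hy := by positivity
  antitone u v hu huv := by
    split_ifs
    · exact le_rfl
    · linarith
    · positivity
    · exact le_rfl
  zero := by simp [hx.le]
  increment u v hu huv := by
    split_ifs with hv
    · rw [min_eq_left hv.le, min_eq_left (huv.trans hv.le)]
      apply le_of_eq
      ring
    · have : min u x / x ≤ min v x / x := by gcongr
      linarith
  le y hy := by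
    have : 0 ≤ min y x / x := div_nonneg (le_min hy hx.le) hx.le
    linarith
  mono u v hu huv := by gcongr
  one_le y hy := by
    split_ifs with hv
    · have : 0 ≤ min y x / x := div_nonneg (le_min hy hx.le) hx.le
      have h2 : 1 / x * (x + y) = 1 + y / x := by field_simp
      have : 0 ≤ y / x := by positivity
      rw [h2]
      linarith
    · rw [min_eq_right (not_lt.1 hv), div_self hx.ne']
      norm_num

end Triples

section Integrals

open Set

lemma lintegral_rpow_Ioc {p : ℝ} (hp : 0 < p) {s : ℝ} (hs : 0 ≤ s) :
    ∫⁻ x in Ioc 0 s, ENNReal.ofReal (p * x ^ (p - 1)) = ENNReal.ofReal (s ^ p) := by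
  have hint : IntervalIntegrable (fun x : ℝ => p * x ^ (p - 1)) volume 0 s :=
    (intervalIntegral.intervalIntegrable_rpow' (by linarith)).const_mul p
  rw [← ofReal_integral_eq_lintegral_ofReal
    ((intervalIntegrable_iff_integrableOn_Ioc_of_le hs).1 hint)]
  · rw [← intervalIntegral.integral_of_le hs, intervalIntegral.integral_const_mul,
      integral_rpow (.inl (by linarith)), sub_add_cancel, Real.zero_rpow hp.ne', sub_zero]
    congr 1
    field_simp
  · filter_upwards [ae_restrict_mem measurableSet_Ioc] with x hx
    have := hx.1
    simp only [Pi.zero_apply]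
    positivity

/-- The layer cake formula for a single value, which may be infinite. -/
lemma le_lintegral_rpow_indicator {p : ℝ} (hp : 0 < p) (s : ℝ≥0∞) :
    s ^ p ≤ ∫⁻ x in Ioi (0 : ℝ), ENNReal.ofReal (p * x ^ (p - 1)) *
      {x : ℝ | ENNReal.ofReal x < s}.indicator 1 x := by
  have key : ∀ r : ℝ≥0, (r : ℝ≥0∞) ≤ s → (r : ℝ≥0∞) ^ p ≤
      ∫⁻ x in Ioi (0 : ℝ), ENNReal.ofReal (p * x ^ (p - 1)) *
        {x : ℝ | ENNReal.ofReal x < s}.indicator 1 x := by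
    intro r hr
    calc (r : ℝ≥0∞) ^ p = ENNReal.ofReal ((r : ℝ) ^ p) := by
          rw [← ENNReal.ofReal_rpow_of_nonneg r.coe_nonneg hp.le, ENNReal.ofReal_coe_nnreal]
      _ = ∫⁻ x in Ioo 0 (r : ℝ), ENNReal.ofReal (p * x ^ (p - 1)) := by
          rw [← lintegral_rpow_Ioc hp r.coe_nonneg]
          exact setLIntegral_congr Ioo_ae_eq_Ioc.symm
      _ ≤ ∫⁻ x in Ioo 0 (r : ℝ), ENNReal.ofReal (p * x ^ (p - 1)) *
          {x : ℝ | ENNReal.ofReal x < s}.indicator 1 x := by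
          refine setLIntegral_mono' measurableSet_Ioo fun x hx => ?_
          rw [indicator_of_mem, Pi.one_apply, mul_one]
          refine lt_of_lt_of_le ?_ hr
          rw [← ENNReal.ofReal_coe_nnreal]
          exact (ENNReal.ofReal_lt_ofReal_iff (hx.1.trans hx.2)).2 hx.2
      _ ≤ _ := lintegral_mono_set Ioo_subset_Ioi_self
  refine ENNReal.le_of_forall_nnreal_lt fun r hr => ?_
  have hr' : (r : ℝ≥0∞) ^ (1 / p) ≤ s := by
    rw [one_div, ENNReal.rpow_inv_le_iff hp]
    exact hr.le
  rw [← ENNReal.coe_rpow_of_nonneg _ (by positivity)] at hr'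
  have := key _ hr'
  rwa [ENNReal.coe_rpow_of_nonneg _ (by positivity), ← ENNReal.rpow_mul,
    one_div_mul_cancel hp.ne', ENNReal.rpow_one] at this

lemma lintegral_rpow_div_add {p : ℝ} (hp0 : 0 < p) (hp1 : p < 1) {u : ℝ} (hu : 0 < u) :
    ∫⁻ x in Ioi (0 : ℝ), ENNReal.ofReal (x ^ (p - 1) / (u + x)) =
      ENNReal.ofReal (Real.pi / Real.sin (Real.pi * p) * u ^ (p - 1)) := by
  have hq : 0 < 1 - p := by linarith
  have hbeta : beta p (1 - p) = Real.pi / Real.sin (Real.pi * p) := by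
    rw [beta, add_sub_cancel, Real.Gamma_one, div_one, Real.Gamma_mul_Gamma_one_sub]
  have hb := beta_pos hp0 hq
  have himage : (fun x : ℝ => x / (u + x)) '' Ioi 0 = Ioo 0 1 := by
    ext y
    constructor
    · rintro ⟨x, hx, rfl⟩
      have hx : 0 < x := hx
      exact ⟨by positivity, (div_lt_one (by positivity)).2 (by linarith)⟩
    · rintro ⟨hy0, hy1⟩
      have h1 : 0 < 1 - y := by linarith
      refine ⟨u * y / (1 - y), mem_Ioi.2 (by positivity), ?_⟩
      simp only
      field_simp
      ring
  have hderiv : ∀ x ∈ Ioi (0 : ℝ),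
      HasDerivWithinAt (fun x : ℝ => x / (u + x)) (u / (u + x) ^ 2) (Ioi 0) x := by
    intro x hx
    have hx : 0 < x := hx
    have := ((hasDerivAt_id x).div ((hasDerivAt_id x).const_add u) (by simp; positivity))
    exact this.hasDerivWithinAt.congr_deriv (by simp)
  have hmono : MonotoneOn (fun x : ℝ => x / (u + x)) (Ioi 0) := by
    intro a ha b hb hab
    have ha : 0 < a := ha
    have hb : 0 < b := hb
    simp only
    rw [div_le_div_iff₀ (by positivity) (by positivity)]
    nlinarith
  -- The substitution `y = x / (u + x)` turns the Beta integral into the integral in question.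
  have h1 := lintegral_image_eq_lintegral_deriv_mul_of_monotoneOn measurableSet_Ioi hderiv hmono
    (fun y => ENNReal.ofReal (1 / beta p (1 - p) * y ^ (p - 1) * (1 - y) ^ (1 - p - 1)))
  rw [himage, ← lintegral_betaPDF, lintegral_betaPDF_eq_one hp0 hq] at h1
  have h2 : ∀ x ∈ Ioi (0 : ℝ), ENNReal.ofReal (x ^ (p - 1) / (u + x)) =
      ENNReal.ofReal (beta p (1 - p) * u ^ (p - 1)) * (ENNReal.ofReal (u / (u + x) ^ 2) *
        ENNReal.ofReal (1 / beta p (1 - p) * (x / (u + x)) ^ (p - 1) *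
          (1 - x / (u + x)) ^ (1 - p - 1))) := by
    intro x hx
    have hx : 0 < x := hx
    have hux : 0 < u + x := by positivity
    rw [← ENNReal.ofReal_mul (by positivity), ← ENNReal.ofReal_mul (by positivity)]
    congr 1
    have h3 : 1 - x / (u + x) = u / (u + x) := by field_simp; ring
    rw [h3, Real.div_rpow hx.le hux.le, Real.div_rpow hu.le hux.le,
      show 1 - p - 1 = -p by ring, Real.rpow_neg hu.le, Real.rpow_neg hux.le,
      Real.rpow_sub_one hux.ne', Real.rpow_sub_one hu.ne']
    have := Real.rpow_pos_of_pos hux p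
    have := Real.rpow_pos_of_pos hu p
    field_simp
  rw [setLIntegral_congr_fun measurableSet_Ioi h2, lintegral_const_mul' _ _ ENNReal.ofReal_ne_top,
    ← h1, mul_one, hbeta]

lemma ofReal_log_eq_lintegral {x i : ℝ} (hx : 0 < x) (hi : 0 ≤ i) :
    ENNReal.ofReal (Real.log (1 + i / x)) =
      ∫⁻ u in Ioc 0 i, ENNReal.ofReal (1 / (u + x)) := by
  have hint : IntervalIntegrable (fun u : ℝ => 1 / (u + x)) volume 0 i := by
    refine ContinuousOn.intervalIntegrable fun u hu => ContinuousAt.continuousWithinAt ?_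
    rw [uIcc_of_le hi] at hu
    have : u + x ≠ 0 := by linarith [hu.1]
    fun_prop (disch := assumption)
  rw [← ofReal_integral_eq_lintegral_ofReal
    ((intervalIntegrable_iff_integrableOn_Ioc_of_le hi).1 hint)]
  · rw [← intervalIntegral.integral_of_le hi,
      intervalIntegral.integral_comp_add_right (fun u => 1 / u) x,
      integral_one_div_of_pos (by linarith) (by linarith)]
    congr 2
    field_simp
    ring
  · filter_upwards [ae_restrict_mem measurableSet_Ioc] with u hu
    have := hu.1
    simp only [Pi.zero_apply]
    positivity

lemma lintegral_rpow_mul_log {p : ℝ} (hp0 : 0 < p) (hp1 : p < 1) {i : ℝ} (hi : 0 ≤ i) :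
    ∫⁻ x in Ioi (0 : ℝ), ENNReal.ofReal (p * x ^ (p - 1)) *
        ENNReal.ofReal (Real.log (1 + i / x)) =
      ENNReal.ofReal (Real.pi / Real.sin (Real.pi * p)) * ENNReal.ofReal (i ^ p) := by
  have hsin : 0 < Real.sin (Real.pi * p) :=
    Real.sin_pos_of_pos_of_lt_pi (by positivity) (by nlinarith [Real.pi_pos])
  calc _ = ∫⁻ x in Ioi (0 : ℝ), ∫⁻ u in Ioc 0 i,
        ENNReal.ofReal (p * x ^ (p - 1)) * ENNReal.ofReal (1 / (u + x)) := by
        refine setLIntegral_congr_fun measurableSet_Ioi fun x hx => ?_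
        rw [ofReal_log_eq_lintegral hx hi, lintegral_const_mul' _ _ ENNReal.ofReal_ne_top]
    _ = ∫⁻ u in Ioc 0 i, ∫⁻ x in Ioi (0 : ℝ),
        ENNReal.ofReal (p * x ^ (p - 1)) * ENNReal.ofReal (1 / (u + x)) := by
        refine lintegral_lintegral_swap (Measurable.aemeasurable ?_)
        simp only [Function.uncurry_def]
        fun_prop
    _ = ∫⁻ u in Ioc 0 i, ENNReal.ofReal (Real.pi / Real.sin (Real.pi * p)) *
        ENNReal.ofReal (p * u ^ (p - 1)) := by
        refine setLIntegral_congr_fun measurableSet_Ioc fun u hu => ?_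
        have hu : 0 < u := hu.1
        rw [← ENNReal.ofReal_mul (by positivity), mul_left_comm, ENNReal.ofReal_mul hp0.le,
          ← lintegral_rpow_div_add hp0 hp1 hu,
          ← lintegral_const_mul' _ _ ENNReal.ofReal_ne_top]
        refine setLIntegral_congr_fun measurableSet_Ioi fun x hx => ?_
        have hx : 0 < x := hx
        rw [← ENNReal.ofReal_mul (by positivity), ← ENNReal.ofReal_mul (by positivity)]
        congr 1
        ring
    _ = _ := by
        rw [lintegral_const_mul' _ _ ENNReal.ofReal_ne_top, lintegral_rpow_Ioc hp0 hi]

lemma lintegral_rpow_mul_min {p : ℝ} (hp0 : 0 < p) (hp1 : p < 1) {i : ℝ} (hi : 0 ≤ i) :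
    ∫⁻ x in Ioi (0 : ℝ), ENNReal.ofReal (p * x ^ (p - 1)) *
        ENNReal.ofReal (2 * (min i x / x)) =
      ENNReal.ofReal (2 / (1 - p)) * ENNReal.ofReal (i ^ p) := by
  have hq : 0 < 1 - p := by linarith
  rcases hi.eq_or_lt with rfl | hi
  · rw [setLIntegral_congr_fun (g := fun _ => 0) measurableSet_Ioi fun x hx => ?_]
    · simp [Real.zero_rpow hp0.ne']
    · simp [min_eq_left (mem_Ioi.1 hx).le]
  have h1 : ∫⁻ x in Ioc 0 i, ENNReal.ofReal (p * x ^ (p - 1)) *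
      ENNReal.ofReal (2 * (min i x / x)) = ENNReal.ofReal (2 * i ^ p) := by
    rw [ENNReal.ofReal_mul two_pos.le, ← lintegral_rpow_Ioc hp0 hi.le,
      ← lintegral_const_mul' _ _ ENNReal.ofReal_ne_top]
    refine setLIntegral_congr_fun measurableSet_Ioc fun x hx => ?_
    rw [min_eq_right hx.2, div_self hx.1.ne', mul_one, mul_comm]
  have h2 : ∫⁻ x in Ioi i, ENNReal.ofReal (p * x ^ (p - 1)) *
      ENNReal.ofReal (2 * (min i x / x)) = ENNReal.ofReal (2 * p / (1 - p) * i ^ p) := by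
    have h3 : ∀ x ∈ Ioi i, ENNReal.ofReal (p * x ^ (p - 1)) *
        ENNReal.ofReal (2 * (min i x / x)) = ENNReal.ofReal (2 * p * i * x ^ (p - 2)) := by
      intro x hx
      have hx' : 0 < x := hi.trans hx
      rw [min_eq_left (le_of_lt hx), ← ENNReal.ofReal_mul (by positivity),
        show p - 2 = p - 1 - 1 by ring, Real.rpow_sub_one hx'.ne' (p - 1)]
      congr 1
      ring
    rw [setLIntegral_congr_fun measurableSet_Ioi h3, ← ofReal_integral_eq_lintegral_ofReal
      ((integrableOn_Ioi_rpow_of_lt (by linarith) hi).const_mul _)]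
    · rw [integral_const_mul, integral_Ioi_rpow_of_lt (by linarith) hi,
        show p - 2 + 1 = p - 1 by ring, Real.rpow_sub_one hi.ne']
      congr 1
      have : p - 1 ≠ 0 := by linarith
      field_simp
      ring
    · filter_upwards [ae_restrict_mem measurableSet_Ioi] with x hx
      have hx' : 0 < x := hi.trans hx
      simp only [Pi.zero_apply]
      positivity
  rw [← Ioc_union_Ioi_eq_Ioi hi.le, lintegral_union measurableSet_Ioi
    (Ioc_disjoint_Ioi le_rfl), h1, h2, ← ENNReal.ofReal_add (by positivity) (by positivity),
    ← ENNReal.ofReal_mul (by positivity)]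
  congr 1
  field_simp
  ring

end Integrals

/-! ### From tails to moments -/

section Moments

variable {Ω : Type*} {mΩ : MeasurableSpace Ω} {P : Measure Ω} [IsProbabilityMeasure P]
  {𝓕 : Filtration ℝ≥0 mΩ} {M : ℝ≥0 → Ω → ℝ} {p : ℝ}

lemma ofReal_neg_le_toENNReal_neg_iInf {ι : Type*} (f : ι → ℝ) (t : ι) :
    ENNReal.ofReal (-f t) ≤ (-⨅ s, (f s : EReal)).toENNReal := by
  rw [← EReal.real_coe_toENNReal, EReal.coe_neg]
  exact EReal.toENNReal_le_toENNReal (EReal.neg_le_neg_iff.2 (iInf_le _ t))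

/-- A family of triples, one for each level `x`, turns into a moment inequality, with the constant
found by integrating `H x y` in `x`. -/
lemma lintegral_iSup_rpow_le {g G H : ℝ → ℝ → ℝ} {C : ℝ≥0∞}
    (h : ∀ x, 0 < x → IsAzemaYorTriple x (g x) (G x) (H x))
    (hH : Measurable fun q : ℝ × ℝ => H q.1 q.2) (hC : C ≠ 0) (hp : 0 < p)
    (hbound : ∀ y, 0 ≤ y → ∫⁻ x in Set.Ioi (0 : ℝ), ENNReal.ofReal (p * x ^ (p - 1)) *
      ENNReal.ofReal (H x y) ≤ C * ENNReal.ofReal (y ^ p))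
    (hM : IsContinuousLocalMartingale M 𝓕 P) (hM0 : ∀ᵐ ω ∂P, M 0 ω = 0) :
    ∫⁻ ω, ⨆ t : ℝ≥0, ENNReal.ofReal (M t ω) ^ p ∂P ≤
      C * ∫⁻ ω, (-⨅ t : ℝ≥0, (M t ω : EReal)).toENNReal ^ p ∂P := by
  have hMm : ∀ t, Measurable (M t) := fun t =>
    (hM.stronglyAdapted t).measurable.mono (𝓕.le t) le_rfl
  -- Suprema over a countable dense set of times are measurable; by continuity they agree almost
  -- surely with the full suprema.
  let d := TopologicalSpace.denseSeq ℝ≥0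
  have hd : DenseRange d := TopologicalSpace.denseRange_denseSeq ℝ≥0
  set S : Ω → ℝ≥0∞ := fun ω => ⨆ n, ENNReal.ofReal (M (d n) ω) with hS
  set D : Ω → ℝ≥0∞ := fun ω => ⨆ n, ENNReal.ofReal (-M (d n) ω) with hD
  have hSm : Measurable S := .iSup fun n => (hMm _).ennreal_ofReal
  have hDm : Measurable D := .iSup fun n => (hMm _).neg.ennreal_ofReal
  have hDle : ∫⁻ ω, D ω ^ p ∂P ≤ ∫⁻ ω, (-⨅ t : ℝ≥0, (M t ω : EReal)).toENNReal ^ p ∂P :=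
    lintegral_mono fun ω => ENNReal.rpow_le_rpow
      (iSup_le fun n => ofReal_neg_le_toENNReal_neg_iInf (fun t => M t ω) (d n)) hp.le
  refine le_trans ?_ (mul_le_mul_right hDle C)
  by_cases hfin : ∫⁻ ω, D ω ^ p ∂P = ∞
  · simp [hfin, hC]
  have hDtop : ∀ᵐ ω ∂P, D ω < ∞ := by
    filter_upwards [ae_lt_top (hDm.pow_const p) hfin] with ω hω
    exact (ENNReal.rpow_lt_top_iff_of_pos hp).1 hω
  have hi : ∀ᵐ ω ∂P, ∀ t, -M t ω ≤ (D ω).toReal := by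
    filter_upwards [hDtop, hM.ae_continuous] with ω hω hc
    intro t
    refine hd.induction_on (p := fun t => -M t ω ≤ (D ω).toReal) t
      (isClosed_le hc.neg continuous_const) fun n => ?_
    rw [← ENNReal.ofReal_le_iff_le_toReal hω.ne]
    exact le_iSup (fun n => ENNReal.ofReal (-M (d n) ω)) n
  have htail : ∀ x ∈ Set.Ioi (0 : ℝ), P {ω | ENNReal.ofReal x < S ω} ≤
      ∫⁻ ω, ENNReal.ofReal (H x (D ω).toReal) ∂P := by
    intro x hx
    refine le_trans (measure_mono ?_)
      ((h x hx).measure_exists_lt hx hM hM0 (fun ω => ENNReal.toReal_nonneg) hi)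
    intro ω hω
    obtain ⟨n, hn⟩ := lt_iSup_iff.1 (show ENNReal.ofReal x < S ω from hω)
    exact ⟨d n, (ENNReal.ofReal_lt_ofReal_iff'.1 hn).1⟩
  have hSle : ∀ᵐ ω ∂P, ∀ t, ENNReal.ofReal (M t ω) ≤ S ω := by
    filter_upwards [hM.ae_continuous] with ω hc t
    exact hd.induction_on (p := fun t => ENNReal.ofReal (M t ω) ≤ S ω) t
      (isClosed_le (ENNReal.continuous_ofReal.comp hc) continuous_const)
      fun n => le_iSup (fun n => ENNReal.ofReal (M (d n) ω)) n
  calc ∫⁻ ω, ⨆ t : ℝ≥0, ENNReal.ofReal (M t ω) ^ p ∂P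
      ≤ ∫⁻ ω, S ω ^ p ∂P := by
        refine lintegral_mono_ae ?_
        filter_upwards [hSle] with ω hω
        exact iSup_le fun t => ENNReal.rpow_le_rpow (hω t) hp.le
    _ ≤ ∫⁻ ω, (∫⁻ x in Set.Ioi (0 : ℝ), ENNReal.ofReal (p * x ^ (p - 1)) *
          {x : ℝ | ENNReal.ofReal x < S ω}.indicator 1 x) ∂P :=
        lintegral_mono fun ω => le_lintegral_rpow_indicator hp (S ω)
    _ = ∫⁻ x in Set.Ioi (0 : ℝ), ∫⁻ ω, ENNReal.ofReal (p * x ^ (p - 1)) *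
          {x : ℝ | ENNReal.ofReal x < S ω}.indicator 1 x ∂P := by
        refine lintegral_lintegral_swap (Measurable.aemeasurable ?_)
        have hset : MeasurableSet {q : Ω × ℝ | ENNReal.ofReal q.2 < S q.1} :=
          measurableSet_lt measurable_snd.ennreal_ofReal (hSm.comp measurable_fst)
        have h1 : Measurable fun q : Ω × ℝ => ENNReal.ofReal (p * q.2 ^ (p - 1)) := by fun_prop
        exact h1.mul ((measurable_const (a := (1 : ℝ≥0∞))).indicator hset)
    _ ≤ ∫⁻ x in Set.Ioi (0 : ℝ), ∫⁻ ω, ENNReal.ofReal (p * x ^ (p - 1)) *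
          ENNReal.ofReal (H x (D ω).toReal) ∂P := by
        refine setLIntegral_mono' measurableSet_Ioi fun x hx => ?_
        rw [lintegral_const_mul' _ _ ENNReal.ofReal_ne_top,
          lintegral_const_mul' _ _ ENNReal.ofReal_ne_top]
        refine mul_le_mul_right (le_of_eq_of_le ?_ (htail x hx)) _
        rw [← lintegral_indicator_one (measurableSet_lt measurable_const hSm)]
        rfl
    _ = ∫⁻ ω, (∫⁻ x in Set.Ioi (0 : ℝ), ENNReal.ofReal (p * x ^ (p - 1)) *
          ENNReal.ofReal (H x (D ω).toReal)) ∂P := by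
        refine lintegral_lintegral_swap (Measurable.aemeasurable ?_)
        have h1 : Measurable fun q : ℝ × Ω => ENNReal.ofReal (p * q.1 ^ (p - 1)) := by fun_prop
        exact h1.mul
          (hH.comp (measurable_fst.prodMk (hDm.comp measurable_snd).ennreal_toReal)).ennreal_ofReal
    _ ≤ ∫⁻ ω, C * D ω ^ p ∂P := by
        refine lintegral_mono_ae ?_
        filter_upwards [hDtop] with ω hω
        refine (hbound _ ENNReal.toReal_nonneg).trans_eq ?_
        rw [← ENNReal.ofReal_rpow_of_nonneg ENNReal.toReal_nonneg hp.le,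
          ENNReal.ofReal_toReal hω.ne]
    _ = C * ∫⁻ ω, D ω ^ p ∂P := lintegral_const_mul _ (hDm.pow_const p)

end Moments

/-- Expectations are taken in `[0, ∞]`. On the left, `ENNReal.ofReal` replaces `M t ω` by its
positive part, which does not change the supremum since `M 0 = 0`; on the right the infimum is
taken in the extended reals and is `≤ 0` almost surely. -/
theorem proposition1 {Ω : Type*} {mΩ : MeasurableSpace Ω} (P : Measure Ω) [IsProbabilityMeasure P]
    (𝓕 : Filtration ℝ≥0 mΩ) (M : ℝ≥0 → Ω → ℝ) (hM : IsContinuousLocalMartingale M 𝓕 P)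
    (hM0 : ∀ᵐ ω ∂P, M 0 ω = 0) (p : ℝ) (hp0 : 0 < p) (hp1 : p < 1) :
    ∫⁻ ω, ⨆ t : ℝ≥0, ENNReal.ofReal (M t ω) ^ p ∂P ≤
      ENNReal.ofReal (burkholderConst p) *
        ∫⁻ ω, (-⨅ t : ℝ≥0, (M t ω : EReal)).toENNReal ^ p ∂P := by
  have hsin : 0 < Real.sin (Real.pi * p) :=
    Real.sin_pos_of_pos_of_lt_pi (by positivity) (by nlinarith [Real.pi_pos])
  rcases le_total (1 / p) 4 with hp | hp
  · have hc : burkholderConst p = Real.pi / Real.sin (Real.pi * p) := by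
      rw [burkholderConst, min_eq_right hp]
      field_simp
    rw [hc]
    refine lintegral_iSup_rpow_le (fun x hx => isAzemaYorTriple_log hx) (by fun_prop) ?_ hp0
      (fun y hy => (lintegral_rpow_mul_log hp0 hp1 hy).le) hM hM0
    rw [ENNReal.ofReal_ne_zero_iff]
    positivity
  · have hp4 : p ≤ 1 / 4 := by
      rw [le_div_iff₀ hp0] at hp
      linarith
    have hq : 0 < 1 - p := by linarith
    have hc : 2 / (1 - p) ≤ burkholderConst p := by
      have h1 : 1 ≤ Real.pi * p / Real.sin (Real.pi * p) :=
        (one_le_div hsin).2 (Real.sin_le (by positivity))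
      have h2 : 2 / (1 - p) ≤ 4 := by
        rw [div_le_iff₀ hq]
        linarith
      rw [burkholderConst, min_eq_left hp]
      linarith
    refine (lintegral_iSup_rpow_le (fun x hx => isAzemaYorTriple_min hx) (by fun_prop) ?_ hp0
      (fun y hy => (lintegral_rpow_mul_min hp0 hp1 hy).le) hM hM0).trans ?_
    · rw [ENNReal.ofReal_ne_zero_iff]
      positivity
    · gcongr
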